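/- A Polish group is non-archimedean if its identity has a neighborhood base of open subgroups, and CLI if it admits a compatible complete left-invariant metric. For a non-archimedean CLI Polish group $G$ let $\mathrm{dgnb}(G)$ be the set of decreasing sequences $\mathcal G=(G_n)_{n<\omega}$ of open subgroups of $G$ with $G_0=G$ that form a neighborhood base of $1_G$. Let $X(\mathcal G)=\bigcup_k G/G_k$ be the set of all left cosets of the subgroups $G_k$, with $G$ acting by left translation, and let $T_{\mathcal G}$ be the tree of all pairs $(n,C)$, where $n<\omega$ and $C\subseteq X(\mathcal G)$ is a $G_n$-orbit with more than one element, ordered by $(n,C)<(m,D)\iff n<m$ and $C\supseteq D$. This tree is well-founded (it has no infinite strictly increasing sequence). Put $\rho_{\mathcal G}(s)=\sup\{\rho_{\mathcal G}(t)+1: s<t\in T_{\mathcal G}\}$ for $s\in T_{\mathcal G}$, and $\rho(\mathcal G)=\sup\{\rho_{\mathcal G}(s)+1:s\in T_{\mathcal G}\}$. Let $\mathrm{rank}(G)$ be the largest ordinal $\beta$ with $\omega\cdot\beta\le\rho(\mathcal G)$. For $\alpha<\omega_1$, $G$ is called $\alpha$-CLI if $\rho(\mathcal G)\le\omega\cdot\alpha$,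 and L-$\alpha$-CLI if $\mathrm{rank}(G)\le\alpha$. (None of these three notions depends on the choice of $\mathcal G\in\mathrm{dgnb}(G)$.) **Theorem.** For every $\alpha<\omega_1$ there exist non-archimedean CLI Polish groups $G_\alpha$ and $H_\alpha$ with $\mathrm{rank}(G_\alpha)=\mathrm{rank}(H_\alpha)=\alpha$ such that $H_\alpha$ is $\alpha$-CLI, and $G_\alpha$ is L-$\alpha$-CLI but not $\alpha$-CLI (whichever $\mathcal G\in\mathrm{dgnb}(G_\alpha)$ is used to test this). Hence the hierarchy is proper: for all $\beta<\alpha<\omega_1$, the class of $\beta$-CLI groups is strictly contained in the class of L-$\beta$-CLI groups, which is strictly contained in the class of $\alpha$-CLI groups. -/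

import Mathlib

open scoped Ordinal Topology Pointwise

universe u

/-- The rank `ρ(T) = sup {ρ_T(s) + 1 : s ∈ T}` of a well-founded tree `(T, lt)`, where
`ρ_T(s) = sup {ρ_T(t) + 1 : s < t}`. Well-founded means that every non-empty subset of `T` has a
maximal element, so the converse of `lt` is well-founded in the sense of Mathlib.
(The value is `0` by convention if `(T, lt)` is not well-founded.) -/
noncomputable def treeRank {T : Type u} (lt : T → T → Prop) : Ordinal.{u} :=
  open scoped Classical in
  if h : WellFounded (fun s t : T => lt t s) then ⨆ s : T, ((h.apply s).rank + 1) else 0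

/-- A topological group is CLI if it admits a compatible complete left-invariant metric. -/
def IsCLI (G : Type u) [Group G] [τ : TopologicalSpace G] : Prop :=
  ∃ m : MetricSpace G,
    m.toUniformSpace.toTopologicalSpace = τ ∧
    @CompleteSpace G m.toUniformSpace ∧
    ∀ g h k : G, m.dist (g * h) (g * k) = m.dist h k

/-- `dgnb(G)`: decreasing sequences of open subgroups `G = G₀ ⊇ G₁ ⊇ ⋯` that form a neighborhood
base of the identity. -/
structure DGNB (G : Type u) [Group G] [TopologicalSpace G] where
  seq : ℕ → Subgroup G
  isOpen : ∀ n, IsOpen (seq n : Set G)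
  antitone : Antitone seq
  zero : seq 0 = ⊤
  hasBasis : (𝓝 (1 : G)).HasBasis (fun _ : ℕ => True) (fun n => (seq n : Set G))

namespace DGNB

variable {G : Type u} [Group G] [TopologicalSpace G]

/-- In a Polish non-archimedean group, `dgnb(G)` is not empty. -/
theorem nonempty [PolishSpace G] [NonarchimedeanGroup G] : Nonempty (DGNB G) := by
  obtain ⟨U, hU⟩ := (𝓝 (1 : G)).exists_antitone_basis
  choose V hV using fun n => NonarchimedeanGroup.is_nonarchimedean (U n) (hU.1.mem_of_mem trivial)
  let W : ℕ → OpenSubgroup G := fun n => Nat.rec ⊤ (fun k W => W ⊓ V k) n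
  have hWs : ∀ n, W (n + 1) = W n ⊓ V n := fun _ => rfl
  have hanti : Antitone W := antitone_nat_of_succ_le fun n => (hWs n).le.trans inf_le_left
  refine ⟨⟨fun n => (W n).toSubgroup, fun n => (W n).isOpen', fun m n h => hanti h, rfl, ?_⟩⟩
  refine Filter.hasBasis_iff.2 fun t => ⟨fun ht => ?_, ?_⟩
  · obtain ⟨n, -, hn⟩ := hU.1.mem_iff.1 ht
    refine ⟨n + 1, trivial, fun x hx => hn (hV n ?_)⟩
    have hx' : x ∈ W n ⊓ V n := hx
    exact (OpenSubgroup.mem_inf.1 hx').2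
  · rintro ⟨n, -, hn⟩
    exact Filter.mem_of_superset ((W n).mem_nhds_one) hn

/-- The tree `T_𝒢^X` of all pairs `(n, C)` where `C = G_n · x ≠ {x}` is a non-singleton
`G_n`-orbit in `X`. -/
def orbitTree (𝒢 : DGNB G) (X : Type u) [MulAction G X] : Set (ℕ × Set X) :=
  {p | ∃ x : X, p.2 = MulAction.orbit (𝒢.seq p.1) x ∧ p.2 ≠ {x}}

/-- The tree order: `(n, C) < (m, D)` iff `n < m` and `C ⊇ D`. -/
def orbitTreeLT (𝒢 : DGNB G) (X : Type u) [MulAction G X] (s t : 𝒢.orbitTree X) : Prop :=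
  s.1.1 < t.1.1 ∧ t.1.2 ⊆ s.1.2

/-- `X(𝒢) = ⋃ₖ G/Gₖ`, the set of all left cosets of all the `Gₖ`, on which `G` acts by left
translation. -/
def cosetSpace (𝒢 : DGNB G) : SubMulAction G (Set G) where
  carrier := {C | ∃ (k : ℕ) (h : G), C = h • (𝒢.seq k : Set G)}
  smul_mem' := by
    rintro g _ ⟨k, h, rfl⟩
    exact ⟨k, g * h, smul_smul g h _⟩

/-- `ρ(𝒢)`, the rank of the tree `T_𝒢^{X(𝒢)}`. -/
noncomputable def rho (𝒢 : DGNB G) : Ordinal.{u} :=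
  treeRank (𝒢.orbitTreeLT 𝒢.cosetSpace)

/-- The largest ordinal `β` with `ω · β ≤ ρ(𝒢)`; see `DGNB.le_rank_iff`. -/
noncomputable def rank (𝒢 : DGNB G) : Ordinal.{u} :=
  𝒢.rho / ω

theorem le_rank_iff (𝒢 : DGNB G) (β : Ordinal.{u}) : β ≤ 𝒢.rank ↔ ω * β ≤ 𝒢.rho :=
  (Ordinal.mul_le_iff_le_div Ordinal.omega0_ne_zero).symm

end DGNB

/-- Non-archimedean CLI Polish groups. -/
structure NonarchCLIPolishGroup : Type (u + 1) where
  carrier : Type u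
  [group : Group carrier]
  [topologicalSpace : TopologicalSpace carrier]
  [nonarchimedean : NonarchimedeanGroup carrier]
  [polish : PolishSpace carrier]
  cli : IsCLI carrier

namespace NonarchCLIPolishGroup

attribute [instance] group topologicalSpace nonarchimedean polish

/-- `rank(G) = β`. -/
def HasRank (G : NonarchCLIPolishGroup.{u}) (β : Ordinal.{u}) : Prop :=
  ∀ 𝒢 : DGNB G.carrier, 𝒢.rank = β

/-- `G` is `α`-CLI. -/
def IsAlphaCLI (α : Ordinal.{u}) (G : NonarchCLIPolishGroup.{u}) : Prop :=
  ∀ 𝒢 : DGNB G.carrier, 𝒢.rho ≤ ω * α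

/-- `G` is L-`α`-CLI. -/
def IsLAlphaCLI (α : Ordinal.{u}) (G : NonarchCLIPolishGroup.{u}) : Prop :=
  ∀ 𝒢 : DGNB G.carrier, 𝒢.rank ≤ α

end NonarchCLIPolishGroup

/-!
The tree of orbits is studied through stabilizers. For a sequence `S` of subgroups and a subgroup
`V`, the relation `RankLE S γ n V` bounds by `γ` the part of the tree that lies, from level `n` on,
below a point with stabilizer `V`; a step down the tree replaces `V` by one of its conjugates
by an element of `S n`. The bound `ρ(𝒢) ≤ γ`, together with well-foundedness, becomes the condition
`DGNB.Bounded`: `RankLE 𝒢.seq γ 0 V` for all open `V` (`DGNB.bounded_iff`). This relation passes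
to finite intersections (`RankLE.inf`), to preimages and to images under homomorphisms
(`RankLE.comap`, `RankLE.of_comap`), and replacing `𝒢` by another member of `dgnb(G)` changes a bound
`ω * β + k` only in its finite part, and not at all if `k = 0` (`DGNB.Bounded.exists_nat`). It
therefore suffices to know the rank for a single sequence.

The groups are built by recursion on `α`.

* `H_α` is the product of infinitely many copies of `G_β` for each `β < α`. An open subgroup of the
  product only depends on finitely many coordinates, so that `ρ ≤ ω * α` is inherited from the
  factors (`DGNB.bounded_pi`). On the other hand, a full factor `G_β` survives in `𝒢.seq m` for
  any given `m`, so that `ρ` exceeds `ω * β + m` (`DGNB.exists_eval_bounded`). Hence `ρ = ω * α`.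
* `G_α` is the semidirect product `A ⋊ H_α`, where the discrete group `A` is free over the set of all
  cosets of the members of some `𝒢` in `dgnb(H_α)`. In a sequence that starts with `A ⋊ H_α` and
  goes on inside `H_α`, only the first step adds to the rank (`SemidirectProduct.bounded_dgnb`). It
  does so because `A`, as the coset space of `H_α`, is a single orbit of `G_α` that contains points
  with arbitrarily small stabilizers in `H_α` (`SemidirectProduct.exists_lt_bounded`). Hence
  `ρ = ω * α + 1`.

All these groups are CLI since they are complete for their left uniformity: `LeftComplete` passes to
products and to semidirect products with a discrete kernel, and it gives a complete left-invariant
ultrametric (`LeftComplete.isCLI`).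
-/

universe v

/-! ### Ranks of subgroups along a sequence of subgroups -/

/-- The conjugate `g⁻¹ V g = {h | g h g⁻¹ ∈ V}`. -/
def conjSubgroup {G : Type*} [Group G] (V : Subgroup G) (g : G) : Subgroup G :=
  V.comap (MulAut.conj g).toMonoidHom

theorem mem_conjSubgroup {G : Type*} [Group G] {V : Subgroup G} {g h : G} :
    h ∈ conjSubgroup V g ↔ g * h * g⁻¹ ∈ V := Iff.rfl

theorem conjSubgroup_one {G : Type*} [Group G] (V : Subgroup G) : conjSubgroup V 1 = V := by
  ext h; simp [mem_conjSubgroup]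

theorem conjSubgroup_conjSubgroup {G : Type*} [Group G] (V : Subgroup G) (g h : G) :
    conjSubgroup (conjSubgroup V g) h = conjSubgroup V (g * h) := by
  ext k; simp [mem_conjSubgroup, mul_assoc]

theorem conjSubgroup_mono {G : Type*} [Group G] {V W : Subgroup G} (h : V ≤ W) (g : G) :
    conjSubgroup V g ≤ conjSubgroup W g := fun _ hk => h hk

theorem isOpen_conjSubgroup {G : Type*} [Group G] [TopologicalSpace G] [IsTopologicalGroup G]
    {V : Subgroup G} (hV : IsOpen (V : Set G)) (g : G) : IsOpen (conjSubgroup V g : Set G) :=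
  hV.preimage (IsTopologicalGroup.continuous_conj g)

/-- `RankLE S γ n V`: let `x` be a point with stabilizer `V` in some `G`-set. Then the nodes
`(m, S m • y)` with `m ≥ n` and `y ∈ S n • x` of the tree of non-singleton orbits form a
well-founded tree of rank at most `γ`. As the stabilizers of the points of `S n • x` are the
conjugates of `V` by elements of `S n`, this only depends on `V`. -/
inductive RankLE {G : Type*} [Group G] (S : ℕ → Subgroup G) :
    Ordinal.{v} → ℕ → Subgroup G → Prop
  | triv {γ : Ordinal.{v}} {n : ℕ} {V : Subgroup G} (h : S n ≤ V) : RankLE S γ n V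
  | step {γ : Ordinal.{v}} {n : ℕ} {V : Subgroup G} (δ : Ordinal.{v}) (hδ : δ < γ)
      (h : ∀ g ∈ S n, RankLE S δ (n + 1) (conjSubgroup V g)) : RankLE S γ n V

namespace RankLE

variable {G : Type*} [Group G] {S : ℕ → Subgroup G}

theorem mono {γ γ' : Ordinal.{v}} {n : ℕ} {V V' : Subgroup G} (h : RankLE S γ n V) (hγ : γ ≤ γ')
    (hV : V ≤ V') : RankLE S γ' n V' := by
  induction h generalizing γ' V' with
  | triv h => exact triv (h.trans hV)
  | step δ hδ _ ih =>
    exact step δ (hδ.trans_le hγ) fun g hg => ih g hg le_rfl (conjSubgroup_mono hV g)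

theorem _root_.le_conjSubgroup_succ (hS : Antitone S) {n : ℕ} {V : Subgroup G} (h : S n ≤ V)
    {g : G} (hg : g ∈ S n) : S (n + 1) ≤ conjSubgroup V g := fun _ hk =>
  h (mul_mem (mul_mem hg (hS n.le_succ hk)) (inv_mem hg))

theorem inf_of_le (hS : Antitone S) {γ : Ordinal.{v}} {n : ℕ} {V W : Subgroup G} (hV : S n ≤ V)
    (hW : RankLE S γ n W) : RankLE S γ n (V ⊓ W) := by
  induction hW generalizing V with
  | triv h => exact triv (le_inf hV h)
  | step δ hδ _ ih => exact step δ hδ fun g hg => ih g hg (le_conjSubgroup_succ hS hV hg)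

/-- The rank of an intersection is at most the larger one of the ranks: a product of orbits is
non-trivial only if one of the factors is. -/
theorem inf (hS : Antitone S) {γ : Ordinal.{v}} {n : ℕ} {V W : Subgroup G} (hV : RankLE S γ n V)
    (hW : RankLE S γ n W) : RankLE S γ n (V ⊓ W) := by
  suffices ∀ γ', RankLE S γ' n W → RankLE S (max γ γ') n (V ⊓ W) by
    simpa using this γ hW
  clear hW
  induction hV generalizing W with
  | triv h => exact fun γ' hW => (inf_of_le hS h hW).mono (le_max_right _ _) le_rfl
  | @step γ n V δ hδ hV ih =>
    intro γ' hW
    cases hW with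
    | triv h =>
      refine (inf_of_le hS h (step δ hδ hV)).mono (le_max_left _ _) ?_
      rw [inf_comm]
    | step δ' hδ' hW =>
      exact step (max δ δ') (max_lt_max hδ hδ') fun g hg => ih g hg δ' (hW g hg)

theorem finset_inf (hS : Antitone S) {γ : Ordinal.{v}} {n : ℕ} {ι : Type*} (F : Finset ι)
    {V : ι → Subgroup G} (h : ∀ i ∈ F, RankLE S γ n (V i)) : RankLE S γ n (F.inf V) := by
  classical
  induction F using Finset.induction_on with
  | empty => exact triv le_top
  | insert i F _ ih =>
    rw [Finset.inf_insert]
    exact inf hS (h i (F.mem_insert_self i)) (ih fun j hj => h j (Finset.mem_insert_of_mem hj))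

/-- Each level of the tree contributes at most `1` to the rank. -/
theorem of_forall_conj (hS : Antitone S) {γ : Ordinal.{v}} (d : ℕ) {m : ℕ} {V : Subgroup G}
    (h : ∀ g ∈ S m, RankLE S γ (m + d) (conjSubgroup V g)) : RankLE S (γ + d) m V := by
  induction d generalizing m V with
  | zero => simpa [conjSubgroup_one] using h 1 (one_mem _)
  | succ d ih =>
    refine step (γ + d) ?_ fun g hg => ih fun k hk => ?_
    · rw [Nat.cast_succ, ← add_assoc, ← Order.succ_eq_add_one]
      exact Order.lt_succ _
    rw [conjSubgroup_conjSubgroup, add_right_comm]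
    exact h _ (mul_mem hg (hS m.le_succ hk))

/-- While the whole group acts, every level of the tree contributes `1` to the rank. -/
theorem of_add_of_eq_top {γ : Ordinal.{v}} {d m : ℕ} (hS : ∀ n ≤ m + d, S n = ⊤)
    {V : Subgroup G} (h : RankLE S (γ + d) m V) : RankLE S γ (m + d) V := by
  induction d generalizing m with
  | zero => simpa using h
  | succ d ih =>
    cases h with
    | triv h => exact triv (by rwa [hS _ le_rfl, ← hS m (by omega)])
    | step δ hδ h =>
      have h1 := h 1 (one_mem _)
      rw [conjSubgroup_one] at h1
      rw [← add_assoc, add_right_comm]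
      refine ih (fun n hn => hS n (by omega)) (h1.mono ?_ le_rfl)
      rw [Nat.cast_succ, ← add_assoc, ← Order.succ_eq_add_one] at hδ
      exact Order.lt_succ_iff.1 hδ

theorem shift_iff {γ : Ordinal.{v}} {n m : ℕ} {V : Subgroup G} :
    RankLE (fun k => S (m + k)) γ n V ↔ RankLE S γ (m + n) V := by
  constructor
  · intro h
    induction h with
    | triv h => exact triv h
    | step δ hδ _ ih => exact step δ hδ ih
  · intro h
    generalize hk : m + n = k at h
    induction h generalizing n with
    | triv h => subst hk; exact triv h
    | step δ hδ _ ih => subst hk; exact step δ hδ fun g hg => ih g hg rfl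

variable {G' : Type*} [Group G'] {S' : ℕ → Subgroup G'}

theorem comap {φ : G →* G'} (hφ : ∀ n, (S n).map φ ≤ S' n) {γ : Ordinal.{v}} {n : ℕ}
    {V : Subgroup G'} (h : RankLE S' γ n V) : RankLE S γ n (V.comap φ) := by
  induction h with
  | triv h => exact triv (Subgroup.map_le_iff_le_comap.1 ((hφ _).trans h))
  | @step γ n V δ hδ _ ih =>
    refine step δ hδ fun g hg => ?_
    have := ih (φ g) (hφ n (Subgroup.mem_map_of_mem φ hg))
    convert this using 1
    ext k
    simp [mem_conjSubgroup]

theorem of_comap {φ : G →* G'} (hφ : ∀ n, S' n ≤ (S n).map φ) {γ : Ordinal.{v}} {n : ℕ}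
    {V : Subgroup G'} (h : RankLE S γ n (V.comap φ)) : RankLE S' γ n V := by
  generalize hW : V.comap φ = W at h
  induction h generalizing V with
  | triv h =>
    subst hW
    exact triv ((hφ _).trans (Subgroup.map_le_iff_le_comap.2 h))
  | @step γ n W δ hδ _ ih =>
    subst hW
    refine step δ hδ fun g hg => ?_
    obtain ⟨g', hg', rfl⟩ := hφ n hg
    refine ih g' hg' ?_
    ext k
    simp [mem_conjSubgroup]

/-- Passing to another sequence of subgroups changes the rank by a finite amount only, where
"finite" is uniform over all `V` of the same rank `ω * β + k`. -/
theorem change_seq {T : ℕ → Subgroup G} (hT : Antitone T) {f : ℕ → ℕ} (hf : Monotone f)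
    (hTS : ∀ n, T (f n) ≤ S n) {γ : Ordinal.{v}} {n : ℕ} {V : Subgroup G} (h : RankLE S γ n V)
    {β : Ordinal.{v}} {k : ℕ} (hγ : γ ≤ ω * β + k) :
    RankLE T (ω * β + (f (n + k) - f n : ℕ)) (f n) V := by
  induction h generalizing β k with
  | triv h => exact triv ((hTS _).trans h)
  | @step γ n V δ hδ _ ih =>
    have key : ∀ (β : Ordinal.{v}) (k : ℕ), δ ≤ ω * β + k →
        RankLE T (ω * β + (f (n + 1 + k) - f n : ℕ)) (f n) V := by
      intro β k hk
      have h1 := hf n.le_succ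
      have h2 := hf (Nat.le_add_right (n + 1) k)
      obtain ⟨d, hd⟩ := Nat.exists_eq_add_of_le h1
      have : RankLE T (ω * β + (f (n + 1 + k) - f (n + 1) : ℕ) + d) (f n) V := by
        refine of_forall_conj hT d fun g hg => ?_
        rw [← hd]
        exact ih g (hTS n hg) hk
      rw [add_assoc, ← Nat.cast_add] at this
      convert this using 4
      simp only [Nat.succ_eq_add_one] at *
      omega
    cases k with
    | succ k =>
      have := key β k (by
        have := hδ.trans_le hγ
        rwa [Nat.cast_succ, ← add_assoc, ← Order.succ_eq_add_one, Order.lt_succ_iff] at this)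
      rwa [add_assoc, add_comm 1 k] at this
    | zero =>
      -- a rank is never a limit ordinal, so that here `δ` has a smaller multiple of `ω` below it
      obtain ⟨k, hk⟩ := Ordinal.lt_omega0.1 (Ordinal.mod_lt δ Ordinal.omega0_ne_zero)
      have hδβ : δ < ω * β := by simpa using hδ.trans_le hγ
      have hβ := (Ordinal.lt_mul_iff_div_lt Ordinal.omega0_ne_zero).1 hδβ
      refine (key (δ / ω) k ?_).mono ?_ le_rfl
      · rw [← hk, Ordinal.div_add_mod]
      · calc ω * (δ / ω) + (f (n + 1 + k) - f n : ℕ) ≤ ω * (δ / ω) + ω := by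
              gcongr; exact (Ordinal.natCast_lt_omega0 _).le
          _ = ω * Order.succ (δ / ω) := (Ordinal.mul_succ _ _).symm
          _ ≤ ω * β := by gcongr; exact Order.succ_le_of_lt hβ
          _ ≤ _ := le_self_add

end RankLE

/-! ### The rank of the tree of orbits -/

theorem conjSubgroup_stabilizer {G X : Type*} [Group G] [MulAction G X] (x : X) (g : G) :
    conjSubgroup (MulAction.stabilizer G x) g = MulAction.stabilizer G (g⁻¹ • x) := by
  ext h
  simp only [mem_conjSubgroup, MulAction.mem_stabilizer_iff, mul_smul]
  rw [eq_inv_smul_iff]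

theorem orbit_eq_singleton {G X : Type*} [Group G] [MulAction G X] {H : Subgroup G} {x : X} (h : H ≤ MulAction.stabilizer G x) :
    MulAction.orbit H x = {x} := by
  ext y
  constructor
  · rintro ⟨g, rfl⟩
    exact h g.2
  · rintro rfl
    exact MulAction.mem_orbit_self _

namespace DGNB

variable {G : Type u} [Group G] [TopologicalSpace G]

/-- `𝒢.Bounded γ` says that `ρ(𝒢) ≤ γ` and that the tree defining `ρ(𝒢)` is well-founded, see
`DGNB.bounded_iff`. -/
def Bounded (𝒢 : DGNB G) (γ : Ordinal.{v}) : Prop :=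
  ∀ V : Subgroup G, IsOpen (V : Set G) → RankLE 𝒢.seq γ 0 V

theorem Bounded.mono {𝒢 : DGNB G} {γ γ' : Ordinal.{v}} (h : 𝒢.Bounded γ) (hγ : γ ≤ γ') :
    𝒢.Bounded γ' := fun V hV => (h V hV).mono hγ le_rfl

theorem exists_seq_le (𝒢 : DGNB G) {V : Subgroup G} (hV : IsOpen (V : Set G)) :
    ∃ n, 𝒢.seq n ≤ V := by
  obtain ⟨n, -, hn⟩ := 𝒢.hasBasis.mem_iff.1 (hV.mem_nhds (one_mem V))
  exact ⟨n, hn⟩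

section Action

variable (𝒢 : DGNB G) {X : Type u} [MulAction G X]

/-- A node at a level `m > n` may skip levels, while `RankLE` descends one level at a time; hence
the statement for all nodes at level `n` or beyond. -/
theorem acc_rank_le_of_rankLE {γ : Ordinal.{u}} {n : ℕ} {V : Subgroup G}
    (h : RankLE 𝒢.seq γ n V) (s : 𝒢.orbitTree X) (hn : n ≤ s.1.1) {x : X}
    (hV : V ≤ MulAction.stabilizer G x) (hs : s.1.2 = MulAction.orbit (𝒢.seq s.1.1) x) :
    ∃ h : Acc (fun s t => 𝒢.orbitTreeLT X t s) s, h.rank + 1 ≤ γ := by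
  induction h generalizing s x with
  | triv h =>
    obtain ⟨y, hy, hy'⟩ := s.2
    have hx := orbit_eq_singleton (((𝒢.antitone hn).trans h).trans hV)
    rw [← hs] at hx
    have : y ∈ s.1.2 := hy ▸ MulAction.mem_orbit_self y
    rw [hx, Set.mem_singleton_iff] at this
    exact absurd (this ▸ hx) hy'
  | @step γ n V δ hδ _ ih =>
    have key : ∀ t, 𝒢.orbitTreeLT X s t →
        ∃ h : Acc (fun s t => 𝒢.orbitTreeLT X t s) t, h.rank + 1 ≤ δ := by
      rintro t ⟨hlt, hsub⟩
      obtain ⟨y, hy, hy'⟩ := t.2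
      have hmem : y ∈ s.1.2 := hsub (hy ▸ MulAction.mem_orbit_self y)
      rw [hs] at hmem
      obtain ⟨⟨g, hg⟩, rfl⟩ := hmem
      refine ih g⁻¹ (inv_mem (𝒢.antitone hn hg)) t (by omega) ?_ hy
      refine (conjSubgroup_mono hV _).trans ?_
      rw [conjSubgroup_stabilizer, inv_inv]
      rfl
    have hacc : Acc (fun s t => 𝒢.orbitTreeLT X t s) s := ⟨_, fun t ht => (key t ht).1⟩
    refine ⟨hacc, ?_⟩
    rw [← Order.succ_eq_add_one, Order.succ_le_iff]
    refine lt_of_le_of_lt ?_ hδ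
    rw [Acc.rank_eq, Ordinal.iSup_le_iff]
    rintro ⟨t, ht⟩
    exact (key t ht).2

theorem rankLE_stabilizer (hwf : WellFounded (fun s t => 𝒢.orbitTreeLT X t s))
    (s : 𝒢.orbitTree X) (x : X) (hs : s.1.2 = MulAction.orbit (𝒢.seq s.1.1) x) :
    RankLE 𝒢.seq ((hwf.apply s).rank + 1) s.1.1 (MulAction.stabilizer G x) := by
  induction s using hwf.induction generalizing x with
  | _ s ih =>
  refine RankLE.step (hwf.apply s).rank (Order.lt_succ _) fun g hg => ?_
  rw [conjSubgroup_stabilizer]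
  by_cases ht : MulAction.orbit (𝒢.seq (s.1.1 + 1)) (g⁻¹ • x) = {g⁻¹ • x}
  · refine RankLE.triv fun k hk => ?_
    have : k • g⁻¹ • x ∈ MulAction.orbit (𝒢.seq (s.1.1 + 1)) (g⁻¹ • x) := ⟨⟨k, hk⟩, rfl⟩
    rwa [ht] at this
  · let t : 𝒢.orbitTree X :=
      ⟨(s.1.1 + 1, MulAction.orbit (𝒢.seq (s.1.1 + 1)) (g⁻¹ • x)), g⁻¹ • x, rfl, ht⟩
    have hst : 𝒢.orbitTreeLT X s t := by
      refine ⟨Nat.lt_succ_self _, ?_⟩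
      rintro _ ⟨⟨k, hk⟩, rfl⟩
      rw [hs]
      exact ⟨⟨k * g⁻¹, mul_mem (𝒢.antitone (Nat.le_succ _) hk) (inv_mem hg)⟩, mul_smul _ _ _⟩
    exact (ih t hst (g⁻¹ • x) rfl).mono
      (Order.succ_le_of_lt (Acc.rank_lt_of_rel (hwf.apply s) hst)) le_rfl

end Action

theorem isOpen_stabilizer_cosetSpace [IsTopologicalGroup G] (𝒢 : DGNB G) (x : 𝒢.cosetSpace) :
    IsOpen (MulAction.stabilizer G x : Set G) := by
  obtain ⟨_, k, h, rfl⟩ := x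
  refine Subgroup.isOpen_mono ?_ (isOpen_conjSubgroup (𝒢.isOpen k) h⁻¹)
  intro g hg
  rw [mem_conjSubgroup, inv_inv] at hg
  refine Subtype.ext ?_
  change g • h • (𝒢.seq k : Set G) = h • (𝒢.seq k : Set G)
  rw [smul_smul, show g * h = h * (h⁻¹ * g * h) by group, ← smul_smul]
  congr 1
  exact smul_coe_set hg

/-- The rank of the tree of orbits, together with its well-foundedness, in terms of `RankLE`. -/
theorem bounded_iff [IsTopologicalGroup G] (𝒢 : DGNB G) (γ : Ordinal.{u}) :
    𝒢.Bounded γ ↔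
      WellFounded (fun s t => 𝒢.orbitTreeLT 𝒢.cosetSpace t s) ∧ 𝒢.rho ≤ γ := by
  constructor
  · intro h
    have key : ∀ s : 𝒢.orbitTree 𝒢.cosetSpace,
        ∃ h : Acc (fun s t => 𝒢.orbitTreeLT 𝒢.cosetSpace t s) s, h.rank + 1 ≤ γ := by
      intro s
      obtain ⟨x, hx, hx'⟩ := s.2
      exact 𝒢.acc_rank_le_of_rankLE (h _ (𝒢.isOpen_stabilizer_cosetSpace x)) s (Nat.zero_le _)
        le_rfl hx
    have hwf : WellFounded (fun s t => 𝒢.orbitTreeLT 𝒢.cosetSpace t s) :=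
      ⟨fun s => (key s).1⟩
    refine ⟨hwf, ?_⟩
    rw [rho, treeRank, dif_pos hwf, Ordinal.iSup_le_iff]
    exact fun s => (key s).2
  · rintro ⟨hwf, hγ⟩ V hV
    obtain ⟨k, hk⟩ := 𝒢.exists_seq_le hV
    let x : 𝒢.cosetSpace := ⟨(𝒢.seq k : Set G), k, 1, (one_smul _ _).symm⟩
    have hx : MulAction.stabilizer G x ≤ V := by
      intro g hg
      have h1 : g • (𝒢.seq k : Set G) = 𝒢.seq k := congrArg Subtype.val hg
      have h2 : g • (1 : G) ∈ g • (𝒢.seq k : Set G) :=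
        Set.smul_mem_smul_set (one_mem (𝒢.seq k))
      rw [h1, smul_eq_mul, mul_one] at h2
      exact hk h2
    by_cases ht : MulAction.orbit (𝒢.seq 0) x = {x}
    · refine RankLE.triv fun g hg => hx ?_
      have : g • x ∈ MulAction.orbit (𝒢.seq 0) x := ⟨⟨g, hg⟩, rfl⟩
      rwa [ht] at this
    · refine (𝒢.rankLE_stabilizer hwf ⟨(0, MulAction.orbit (𝒢.seq 0) x), x, rfl, ht⟩ x rfl).mono
        (le_trans ?_ hγ) hx
      rw [rho, treeRank, dif_pos hwf]
      exact Ordinal.le_iSup (fun s => (hwf.apply s).rank + 1) _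

/-- Any two sequences in `dgnb(G)` have ranks that differ by a finite amount only; multiples of
`ω` are bounds for all of them simultaneously. -/
theorem Bounded.exists_nat {𝒢 : DGNB G} {β : Ordinal.{v}} {k : ℕ} (h : 𝒢.Bounded (ω * β + k))
    (𝒢' : DGNB G) : ∃ c : ℕ, (k = 0 → c = 0) ∧ 𝒢'.Bounded (ω * β + c) := by
  choose m hm using fun n => 𝒢'.exists_seq_le (𝒢.isOpen n)
  let f : ℕ → ℕ := fun n => ∑ i ∈ Finset.range n, m (i + 1)
  have hf : Monotone f := fun a b hab =>
    Finset.sum_le_sum_of_subset (Finset.range_subset_range.2 hab)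
  have hfm : ∀ n, 𝒢'.seq (f n) ≤ 𝒢.seq n := by
    intro n
    cases n with
    | zero => rw [𝒢.zero]; exact le_top
    | succ n =>
      refine (𝒢'.antitone ?_).trans (hm (n + 1))
      rw [show f (n + 1) = f n + m (n + 1) from Finset.sum_range_succ _ _]
      exact Nat.le_add_left _ _
  refine ⟨f k, fun hk => by simp [f, hk], fun V hV => ?_⟩
  simpa [f] using (h V hV).change_seq 𝒢'.antitone hf hfm le_rfl

theorem Bounded.mul_omega {𝒢 : DGNB G} {β : Ordinal.{v}} (h : 𝒢.Bounded (ω * β)) (𝒢' : DGNB G) :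
    𝒢'.Bounded (ω * β) := by
  obtain ⟨c, hc, h'⟩ := Bounded.exists_nat (k := 0) (by simpa using h) 𝒢'
  simpa [hc rfl] using h'

theorem rho_lt_of_bounded [IsTopologicalGroup G] {𝒢 𝒢' : DGNB G} {β : Ordinal.{u}} {k : ℕ}
    (h : 𝒢.Bounded (ω * β + k)) : 𝒢'.rho < ω * Order.succ β := by
  obtain ⟨c, -, hc⟩ := h.exists_nat 𝒢'
  refine ((𝒢'.bounded_iff _).1 hc).2.trans_lt ?_
  rw [Ordinal.mul_succ]
  gcongr
  exact Ordinal.natCast_lt_omega0 c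

/-- The tail of a sequence in `dgnb(G)` whose first members are all equal to `G`. -/
def shift (𝒢 : DGNB G) (m : ℕ) (h : 𝒢.seq m = ⊤) : DGNB G where
  seq n := 𝒢.seq (m + n)
  isOpen n := 𝒢.isOpen _
  antitone _ _ hab := 𝒢.antitone (by omega)
  zero := h
  hasBasis := 𝒢.hasBasis.to_hasBasis (fun n _ => ⟨n, trivial, 𝒢.antitone (by omega)⟩)
    fun n _ => ⟨m + n, trivial, le_rfl⟩

/-- The image of a sequence in `dgnb(G)` under an open continuous epimorphism. -/
def map {G' : Type*} [Group G'] [TopologicalSpace G'] (𝒢 : DGNB G) (φ : G →* G')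
    (hc : Continuous φ) (ho : IsOpenMap φ) (hs : Function.Surjective φ) : DGNB G' where
  seq n := (𝒢.seq n).map φ
  isOpen n := ho _ (𝒢.isOpen n)
  antitone _ _ hab := Subgroup.map_mono (𝒢.antitone hab)
  zero := by rw [𝒢.zero, ← MonoidHom.range_eq_map, MonoidHom.range_eq_top.2 hs]
  hasBasis := by
    have h := 𝒢.hasBasis.map φ
    rwa [ho.map_nhds_eq hc.continuousAt, map_one] at h

theorem Bounded.map {G' : Type*} [Group G'] [TopologicalSpace G'] {𝒢 : DGNB G} {φ : G →* G'}
    {hc : Continuous φ} {ho : IsOpenMap φ} {hs : Function.Surjective φ} {γ : Ordinal.{v}}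
    (h : 𝒢.Bounded γ) : (𝒢.map φ hc ho hs).Bounded γ := fun _ hV =>
  (h _ (hV.preimage hc)).of_comap fun _ => le_rfl

end DGNB

/-! ### Complete left-invariant metrics -/

/-- Every sequence that is Cauchy for the left uniformity converges. Here the left uniformity is
given by the open subgroups, as is appropriate for non-archimedean groups. -/
def LeftComplete (G : Type*) [Group G] [TopologicalSpace G] : Prop :=
  ∀ u : ℕ → G, (∀ V : Subgroup G, IsOpen (V : Set G) → ∃ N, ∀ n ≥ N, (u N)⁻¹ * u n ∈ V) →
    ∃ g, Filter.Tendsto u Filter.atTop (𝓝 g)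

/-- The metric is the one induced by `∏ₙ G ⧸ Gₙ`: the distance of `g` and `h` is `2⁻ⁿ` for the
first `n` with `g Gₙ ≠ h Gₙ`. -/
theorem LeftComplete.isCLI {G : Type u} [Group G] [TopologicalSpace G] [IsTopologicalGroup G]
    [T2Space G] (hG : LeftComplete G) (𝒢 : DGNB G) : IsCLI G := by
  let f : G → ∀ n, G ⧸ 𝒢.seq n := fun g n => (g : G ⧸ 𝒢.seq n)
  have hf : ∀ g h n, f g n = f h n ↔ g⁻¹ * h ∈ 𝒢.seq n := fun g h n => QuotientGroup.eq
  have hinj : Function.Injective f := by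
    intro g h hgh
    have : g⁻¹ * h = 1 := by
      by_contra hne
      obtain ⟨n, -, hn⟩ := 𝒢.hasBasis.mem_iff.1 (isOpen_ne.mem_nhds (Ne.symm hne))
      exact hn ((hf g h n).1 (congrFun hgh n)) rfl
    exact (inv_mul_eq_one.1 this)
  let : ∀ n, TopologicalSpace (G ⧸ 𝒢.seq n) := fun _ => ⊥
  have : ∀ n, DiscreteTopology (G ⧸ 𝒢.seq n) := fun _ => ⟨rfl⟩
  let m : MetricSpace G :=
    MetricSpace.induced f hinj (PiNat.metricSpace (E := fun n => G ⧸ 𝒢.seq n))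
  have hdist : ∀ g h n, m.dist g h ≤ (1 / 2) ^ n ↔ ∀ i < n, g⁻¹ * h ∈ 𝒢.seq i := by
    intro g h n
    refine PiNat.mem_cylinder_iff_dist_le.symm.trans ?_
    exact forall₂_congr fun i _ => hf g h i
  have htop : ‹TopologicalSpace G› = m.toUniformSpace.toTopologicalSpace := by
    refine TopologicalSpace.ext_nhds fun g => ?_
    have h1 : (𝓝 g).HasBasis (fun _ : ℕ => True) (fun n => {h | g⁻¹ * h ∈ 𝒢.seq n}) := by
      have := 𝒢.hasBasis.comap (Homeomorph.mulLeft g⁻¹)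
      rwa [Homeomorph.comap_nhds_eq, show (Homeomorph.mulLeft g⁻¹).symm 1 = g by
        rw [Homeomorph.symm_apply_eq]; simp] at this
    have h2 := @Metric.nhds_basis_closedBall_pow G m.toPseudoMetricSpace g (1 / 2) (by norm_num)
      (by norm_num)
    refine h1.ext h2 (fun n _ => ⟨n + 1, trivial, fun h hh => ?_⟩) fun n _ =>
      ⟨n, trivial, fun h hh => ?_⟩
    · have : m.dist h g ≤ (1 / 2) ^ (n + 1) := hh
      rw [m.dist_comm] at this
      exact (hdist g h _).1 this n n.lt_succ_self
    · change m.dist h g ≤ (1 / 2) ^ n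
      rw [m.dist_comm]
      exact (hdist g h _).2 fun i hi => 𝒢.antitone hi.le hh
  refine ⟨m.replaceTopology htop, rfl, ?_, fun g h k => ?_⟩
  · let := m.replaceTopology htop
    refine Metric.complete_of_convergent_controlled_sequences (fun n => (1 / 2) ^ n)
      (fun n => by positivity) fun u hu => hG u fun V hV => ?_
    obtain ⟨i, hi⟩ := 𝒢.exists_seq_le hV
    refine ⟨i + 1, fun n hn => hi ?_⟩
    exact (hdist (u (i + 1)) (u n) (i + 1)).1 (hu _ _ _ le_rfl hn).le i i.lt_succ_self
  · have key : ∀ x y x' y' : G, x⁻¹ * y = x'⁻¹ * y' → m.dist x' y' ≤ m.dist x y := by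
      intro x y x' y' h
      rcases eq_or_ne x y with rfl | hne
      · rw [inv_mul_cancel, eq_comm, inv_mul_eq_one] at h
        rw [h, m.dist_self, m.dist_self]
      · have hxy : m.dist x y = (1 / 2) ^ PiNat.firstDiff (f x) (f y) :=
          PiNat.dist_eq_of_ne (hinj.ne hne)
        rw [hxy]
        exact (hdist x' y' _).2 fun i hi => h ▸ (hdist x y _).1 hxy.le i hi
    have hgk : (g * h)⁻¹ * (g * k) = h⁻¹ * k := by group
    exact le_antisymm (key _ _ _ _ hgk.symm) (key _ _ _ _ hgk)

/-! ### Countable products -/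

section Pi

variable {ι : Type*} {K : ι → Type*} [∀ i, Group (K i)] [∀ i, TopologicalSpace (K i)]

theorem LeftComplete.pi (h : ∀ i, LeftComplete (K i)) : LeftComplete (∀ i, K i) := by
  intro u hu
  have : ∀ i, ∃ g, Filter.Tendsto (fun n => u n i) Filter.atTop (𝓝 g) := fun i =>
    h i _ fun V hV => hu (V.comap (Pi.evalMonoidHom K i)) (hV.preimage (continuous_apply i))
  choose g hg using this
  exact ⟨g, tendsto_pi_nhds.2 hg⟩

theorem exists_finset_inf_le_of_mem_nhds_one [∀ i, NonarchimedeanGroup (K i)] {U : Set (∀ i, K i)}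
    (hU : U ∈ 𝓝 1) : ∃ (F : Finset ι) (V : ∀ i, OpenSubgroup (K i)),
      ((F.inf fun i => (V i).toSubgroup.comap (Pi.evalMonoidHom K i) : Subgroup (∀ i, K i)) :
        Set (∀ i, K i)) ⊆ U := by
  rw [nhds_pi, Filter.mem_pi] at hU
  obtain ⟨F, hF, t, ht, hFt⟩ := hU
  choose V hV using fun i => NonarchimedeanGroup.is_nonarchimedean (t i) (ht i)
  refine ⟨hF.toFinset, V, fun x hx => hFt fun i hi => hV i ?_⟩
  exact Finset.inf_le (f := fun i => (V i).toSubgroup.comap (Pi.evalMonoidHom K i))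
    (hF.mem_toFinset.2 hi) hx

instance NonarchimedeanGroup.pi [∀ i, NonarchimedeanGroup (K i)] :
    NonarchimedeanGroup (∀ i, K i) where
  is_nonarchimedean U hU := by
    obtain ⟨F, V, hFV⟩ := exists_finset_inf_le_of_mem_nhds_one hU
    refine ⟨⟨F.inf fun i => (V i).toSubgroup.comap (Pi.evalMonoidHom K i), ?_⟩, hFV⟩
    clear hFV
    classical
    induction F using Finset.induction_on with
    | empty => exact isOpen_univ
    | insert i F _ ih =>
      rw [Finset.inf_insert]
      exact ((V i).isOpen'.preimage (continuous_apply i)).inter ih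

/-- The projection of a member of `dgnb(∏ K)` to a factor. -/
noncomputable def DGNB.eval (𝒢 : DGNB (∀ i, K i)) (i : ι) : DGNB (K i) :=
  𝒢.map (Pi.evalMonoidHom K i) (continuous_apply i) (isOpenMap_eval i)
    (by classical exact Function.surjective_eval i)

theorem DGNB.bounded_pi [∀ i, NonarchimedeanGroup (K i)] (𝒢 : DGNB (∀ i, K i)) {γ : Ordinal.{v}}
    (h : ∀ i (𝒢' : DGNB (K i)), 𝒢'.Bounded γ) : 𝒢.Bounded γ := by
  intro V hV
  obtain ⟨F, W, hFW⟩ := exists_finset_inf_le_of_mem_nhds_one (hV.mem_nhds (one_mem V))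
  refine (RankLE.finset_inf 𝒢.antitone F fun i _ => ?_).mono le_rfl hFW
  exact (h i (𝒢.eval i) (W i).toSubgroup (W i).isOpen').comap fun _ => le_rfl

/-- In an infinite product, an open subgroup contains all but finitely many of the factors. So
the full factor `K i` acts on coordinate `i` down to any prescribed level of the tree, for a
suitable `i` in any given infinite set. -/
theorem DGNB.exists_eval_bounded [∀ i, NonarchimedeanGroup (K i)] {𝒢 : DGNB (∀ i, K i)}
    {γ : Ordinal.{v}} {m : ℕ} (h : 𝒢.Bounded (γ + m)) {s : Set ι} (hs : s.Infinite) :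
    ∃ i ∈ s, ∃ 𝒢' : DGNB (K i), 𝒢'.Bounded γ := by
  obtain ⟨F, W, hFW⟩ :=
    exists_finset_inf_le_of_mem_nhds_one ((𝒢.isOpen m).mem_nhds (one_mem (𝒢.seq m)))
  obtain ⟨i, hi, hiF⟩ := hs.exists_notMem_finset F
  have htop : ∀ n ≤ 0 + m, (𝒢.eval i).seq n = ⊤ := by
    classical
    intro n hn
    refine eq_top_iff.2 fun x _ => ⟨Pi.mulSingle i x, 𝒢.antitone (by omega : n ≤ m) (hFW ?_), ?_⟩
    · refine (Finset.le_inf fun j hj => ?_ : Subgroup.zpowers (Pi.mulSingle i x) ≤ _)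
        (Subgroup.mem_zpowers _)
      rw [Subgroup.zpowers_le, Subgroup.mem_comap]
      have hji : j ≠ i := fun h => hiF (h ▸ hj)
      simp [hji, one_mem]
    · exact Pi.mulSingle_eq_same i x
  have h' : (𝒢.eval i).Bounded (γ + m) := h.map
  refine ⟨i, hi, (𝒢.eval i).shift m (htop m (by simp)), fun V hV => ?_⟩
  have := (h' V hV).of_add_of_eq_top htop
  rw [add_comm] at this
  exact RankLE.shift_iff.2 this

end Pi

/-! ### Semidirect products with a discrete normal subgroup -/

namespace SemidirectProduct

variable {A N : Type*} [Group A] [Group N] {φ : N →* MulAut A}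

/-- The product topology on a semidirect product. -/
instance [TopologicalSpace A] [TopologicalSpace N] : TopologicalSpace (A ⋊[φ] N) :=
  TopologicalSpace.induced equivProd inferInstance

variable [TopologicalSpace A] [TopologicalSpace N]

/-- A semidirect product is homeomorphic to the product. -/
def homeomorphProd (φ : N →* MulAut A) : A ⋊[φ] N ≃ₜ A × N :=
  equivProd.toHomeomorphOfIsInducing ⟨rfl⟩

theorem continuous_left : Continuous (left : A ⋊[φ] N → A) :=
  continuous_fst.comp (homeomorphProd φ).continuous

theorem continuous_right : Continuous (right : A ⋊[φ] N → N) :=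
  continuous_snd.comp (homeomorphProd φ).continuous

theorem continuous_mk {Y : Type*} [TopologicalSpace Y] {f : Y → A} {g : Y → N}
    (hf : Continuous f) (hg : Continuous g) : Continuous fun y => (⟨f y, g y⟩ : A ⋊[φ] N) :=
  (homeomorphProd φ).symm.continuous.comp (hf.prodMk hg)

theorem continuous_inr : Continuous (inr : N →* A ⋊[φ] N) :=
  continuous_mk continuous_const continuous_id

variable [DiscreteTopology A]

theorem isOpenMap_inr : IsOpenMap (inr : N →* A ⋊[φ] N) := by
  intro U hU
  convert ((isOpen_discrete {(1 : A)}).preimage continuous_left).inter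
    (hU.preimage (continuous_right (φ := φ))) using 1
  ext x
  constructor
  · rintro ⟨n, hn, rfl⟩
    exact ⟨rfl, hn⟩
  · rintro ⟨h1, h2⟩
    exact ⟨x.right, h2, SemidirectProduct.ext h1.symm rfl⟩

theorem continuous_action [IsTopologicalGroup N] (hφ : ∀ a, IsOpen {n | φ n a = a}) :
    Continuous fun p : N × A => φ p.1 p.2 := by
  rw [continuous_prod_of_discrete_right]
  intro a
  refine continuous_iff_continuousAt.2 fun n => ?_
  rw [ContinuousAt, nhds_discrete A, Filter.tendsto_pure]
  have hopen : IsOpen {k : N | φ (n⁻¹ * k) a = a} := (hφ a).preimage (continuous_const_mul n⁻¹)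
  filter_upwards [hopen.mem_nhds (by simp)] with k hk
  have hk' : φ (n⁻¹ * k) a = a := hk
  rw [map_mul, map_inv, MulAut.mul_apply, MulAut.inv_apply, MulEquiv.symm_apply_eq] at hk'
  exact hk'

theorem isTopologicalGroup [IsTopologicalGroup N] (hφ : ∀ a, IsOpen {n | φ n a = a}) :
    IsTopologicalGroup (A ⋊[φ] N) where
  continuous_mul :=
    continuous_mk
      ((continuous_left.comp continuous_fst).mul ((continuous_action hφ).comp
        ((continuous_right.comp continuous_fst).prodMk (continuous_left.comp continuous_snd))))
      ((continuous_right.comp continuous_fst).mul (continuous_right.comp continuous_snd))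
  continuous_inv :=
    continuous_mk
      ((continuous_action hφ).comp (continuous_right.inv.prodMk continuous_left.inv))
      continuous_right.inv

theorem nonarchimedeanGroup [NonarchimedeanGroup N] (hφ : ∀ a, IsOpen {n | φ n a = a}) :
    NonarchimedeanGroup (A ⋊[φ] N) where
  toIsTopologicalGroup := isTopologicalGroup hφ
  is_nonarchimedean U hU := by
    obtain ⟨V, hV⟩ := NonarchimedeanGroup.is_nonarchimedean ((inr : N →* A ⋊[φ] N) ⁻¹' U)
      (continuous_inr.continuousAt.preimage_mem_nhds (by rwa [map_one]))
    refine ⟨⟨V.toSubgroup.map inr, isOpenMap_inr _ V.isOpen'⟩, ?_⟩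
    rintro _ ⟨n, hn, rfl⟩
    exact hV hn

theorem polishSpace [Countable A] [PolishSpace N] : PolishSpace (A ⋊[φ] N) :=
  (homeomorphProd φ).isClosedEmbedding.polishSpace

theorem leftComplete (hN : LeftComplete N) : LeftComplete (A ⋊[φ] N) := by
  intro u hu
  -- Cosets of the open subgroup `N` are determined by the first component, which is therefore
  -- eventually constant.
  obtain ⟨M, hM⟩ := hu (inr : N →* A ⋊[φ] N).range (by
    rw [MonoidHom.coe_range]
    exact isOpenMap_inr.isOpen_range)
  have hleft : ∀ n ≥ M, (u n).left = (u M).left := by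
    intro n hn
    obtain ⟨k, hk⟩ := hM n hn
    rw [eq_inv_mul_iff_mul_eq] at hk
    rw [← hk]
    simp
  obtain ⟨g, hg⟩ := hN (fun n => (u n).right) fun V hV => by
    exact hu (V.comap rightHom) (hV.preimage continuous_right)
  refine ⟨⟨(u M).left, g⟩, ?_⟩
  have h1 : Filter.Tendsto (fun n => (⟨(u M).left, (u n).right⟩ : A ⋊[φ] N)) Filter.atTop
      (𝓝 ⟨(u M).left, g⟩) :=
    ((continuous_mk continuous_const continuous_id).tendsto g).comp hg
  refine h1.congr' ?_
  filter_upwards [Filter.eventually_ge_atTop M] with n hn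
  exact SemidirectProduct.ext (hleft n hn).symm rfl

/-- A sequence in `dgnb(N)`, preceded by the whole group `A ⋊ N`. -/
def dgnb (𝒢 : DGNB N) : DGNB (A ⋊[φ] N) where
  seq n := Nat.casesOn n ⊤ fun n => (𝒢.seq n).map inr
  isOpen n := by
    cases n with
    | zero => exact isOpen_univ
    | succ n => exact isOpenMap_inr _ (𝒢.isOpen n)
  antitone := by
    refine antitone_nat_of_succ_le fun n => ?_
    cases n with
    | zero => exact le_top
    | succ n => exact Subgroup.map_mono (𝒢.antitone n.le_succ)
  zero := rfl
  hasBasis := by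
    have h := 𝒢.hasBasis.map (inr : N →* A ⋊[φ] N)
    rw [isOpenMap_inr.map_nhds_eq continuous_inr.continuousAt, map_one] at h
    refine h.to_hasBasis (fun n _ => ⟨n + 1, trivial, le_rfl⟩) fun n _ => ⟨n, trivial, ?_⟩
    cases n with
    | zero => exact Set.subset_univ _
    | succ n => exact Set.image_mono (𝒢.antitone n.le_succ)

theorem rankLE_dgnb_succ_iff (𝒢 : DGNB N) {γ : Ordinal.{v}}
    {n : ℕ} {V : Subgroup (A ⋊[φ] N)} :
    RankLE (dgnb (φ := φ) 𝒢).seq γ (n + 1) V ↔ RankLE 𝒢.seq γ n (V.comap inr) := by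
  have h : (fun k => (dgnb (φ := φ) 𝒢).seq (1 + k)) = fun k => (𝒢.seq k).map inr := by
    funext k
    rw [add_comm]
    rfl
  rw [add_comm, ← RankLE.shift_iff, h]
  exact ⟨fun H => H.comap fun _ => le_rfl, fun H => H.of_comap fun _ => le_rfl⟩

theorem bounded_dgnb [IsTopologicalGroup N] (hφ : ∀ a, IsOpen {n | φ n a = a}) {𝒢 : DGNB N} {γ : Ordinal.{v}}
    (h : 𝒢.Bounded γ) : (dgnb (φ := φ) 𝒢).Bounded (γ + 1) := fun V hV => by
  have := isTopologicalGroup hφ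
  refine .step γ (Order.lt_succ γ) fun g _ => (rankLE_dgnb_succ_iff 𝒢).2 (h _ ?_)
  exact (isOpen_conjSubgroup hV g).preimage continuous_inr

/-- If every open subgroup of `N` contains the stabilizer of some `a : A`, then the root of the
tree of `A ⋊ N` lies below trees of all ranks that occur in `N`: on the coset space of `N` in
`A ⋊ N`, that is on `A`, the group `A` acts transitively and `N` acts by `φ`. -/
theorem exists_lt_bounded [Nontrivial A]
    (hA : ∀ V : Subgroup N, IsOpen (V : Set N) → ∃ a, ∀ n, φ n a = a → n ∈ V)
    {𝒢 : DGNB N} {γ : Ordinal.{v}} (h : (dgnb (φ := φ) 𝒢).Bounded γ) : ∃ δ < γ, 𝒢.Bounded δ := by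
  have hopen : IsOpen ((inr : N →* A ⋊[φ] N).range : Set (A ⋊[φ] N)) := by
    rw [MonoidHom.coe_range]
    exact isOpenMap_inr.isOpen_range
  cases h _ hopen with
  | triv h =>
    obtain ⟨a, ha⟩ := exists_ne (1 : A)
    obtain ⟨n, hn⟩ := h (show inl a ∈ (⊤ : Subgroup (A ⋊[φ] N)) from trivial)
    exact absurd (congrArg left hn).symm ha
  | step δ hδ h =>
    refine ⟨δ, hδ, fun V hV => ?_⟩
    obtain ⟨a, ha⟩ := hA V hV
    refine ((rankLE_dgnb_succ_iff 𝒢).1 (h (inl a) trivial)).mono le_rfl fun n hn => ha n ?_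
    obtain ⟨k, hk⟩ := hn
    have hk' := congrArg left hk
    simp only [left_inr, MulEquiv.toMonoidHom_eq_coe, MonoidHom.coe_coe, MulAut.conj_apply,
      mul_left, left_inl, right_inl, map_one, MulAut.one_apply, mul_one, right_inr, mul_right,
      one_mul, inv_left, inv_one] at hk'
    rw [map_inv] at hk'
    exact (mul_inv_eq_one.1 hk'.symm).symm

end SemidirectProduct

/-! ### The action on a free group -/

section FreeGroup

variable (N X : Type*) [Group N] [MulAction N X]

/-- The action by automorphisms on the free group over `X` induced by an action on `X`. -/
def freeGroupAction : N →* MulAut (FreeGroup X) where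
  toFun n := FreeGroup.freeGroupCongr (MulAction.toPerm n)
  map_one' := MulEquiv.toMonoidHom_injective (FreeGroup.ext_hom _ _ fun x => by simp)
  map_mul' m n := MulEquiv.toMonoidHom_injective (FreeGroup.ext_hom _ _ fun x => by
    simp [mul_smul])

variable {N X}

theorem freeGroupAction_of (n : N) (x : X) :
    freeGroupAction N X n (FreeGroup.of x) = FreeGroup.of (n • x) := by
  simp [freeGroupAction]

theorem isOpen_freeGroupAction_eq [TopologicalSpace N] [IsTopologicalGroup N]
    (hX : ∀ x : X, IsOpen (MulAction.stabilizer N x : Set N)) (w : FreeGroup X) :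
    IsOpen {n | freeGroupAction N X n w = w} := by
  let S : FreeGroup X → Subgroup N := fun w =>
    (MulAction.stabilizer (MulAut (FreeGroup X)) w).comap (freeGroupAction N X)
  have hS : ∀ w n, n ∈ S w ↔ freeGroupAction N X n w = w := fun w n => Iff.rfl
  change IsOpen (S w : Set N)
  induction w using FreeGroup.induction_on with
  | C1 => exact Subgroup.isOpen_mono (H₁ := ⊤) (fun n _ => (hS _ n).2 (map_one _)) isOpen_univ
  | of x =>
    refine Subgroup.isOpen_mono (fun n hn => (hS _ n).2 ?_) (hX x)
    exact (freeGroupAction_of n x).trans (congrArg _ hn)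
  | inv_of x ih =>
    exact Subgroup.isOpen_mono (fun n hn => (hS _ n).2 (by rw [map_inv, (hS _ n).1 hn])) ih
  | mul v w hv hw =>
    refine Subgroup.isOpen_mono (H₁ := S v ⊓ S w) (fun n hn => (hS _ n).2 ?_) (hv.inter hw)
    rw [map_mul, (hS v n).1 hn.1, (hS w n).1 hn.2]

end FreeGroup

/-! ### The hierarchy -/

/-- Let `γ` be the rank of a group `N`. Passing to a semidirect product with a suitable countable
discrete group raises the rank to `γ + 1`. -/
theorem exists_bounded_add_one_and_not_bounded (N : Type u) [Group N] [TopologicalSpace N]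
    [NonarchimedeanGroup N] [PolishSpace N] (hN : LeftComplete N) (𝒢 : DGNB N) {γ : Ordinal.{u}}
    (h : 𝒢.Bounded γ) (h' : ∀ δ < γ, ¬ 𝒢.Bounded δ) :
    ∃ G : NonarchCLIPolishGroup.{u}, LeftComplete G.carrier ∧
      ∃ 𝒢' : DGNB G.carrier, 𝒢'.Bounded (γ + 1) ∧ ¬ 𝒢'.Bounded γ := by
  let X := Σ k, N ⧸ 𝒢.seq k
  have hX : ∀ x : X, IsOpen (MulAction.stabilizer N x : Set N) := by
    rintro ⟨k, q⟩
    obtain ⟨g, rfl⟩ := QuotientGroup.mk_surjective q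
    refine Subgroup.isOpen_mono (fun n hn => ?_) (isOpen_conjSubgroup (𝒢.isOpen k) g⁻¹)
    rw [mem_conjSubgroup, inv_inv] at hn
    refine Sigma.ext rfl (heq_of_eq ?_)
    refine (QuotientGroup.eq.2 ?_ : ((n * g : N) : N ⧸ 𝒢.seq k) = g)
    rw [mul_inv_rev, ← inv_mem_iff]
    simpa [mul_assoc] using hn
  have : ∀ k, Countable (N ⧸ 𝒢.seq k) := fun k =>
    have := QuotientGroup.discreteTopology (𝒢.isOpen k)
    TopologicalSpace.separableSpace_iff_countable.1 inferInstance
  let x : ℕ → X := fun k => ⟨k, ((1 : N) : N ⧸ 𝒢.seq k)⟩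
  have hx : ∀ k n, n • x k = x k → n ∈ 𝒢.seq k := by
    intro k n hn
    have h1 : ((n * 1 : N) : N ⧸ 𝒢.seq k) = (1 : N) := eq_of_heq (Sigma.ext_iff.1 hn).2
    rw [QuotientGroup.eq] at h1
    simpa using h1
  let φ := freeGroupAction N X
  have hφ : ∀ w, IsOpen {n | φ n w = w} := isOpen_freeGroupAction_eq hX
  have : Nonempty X := ⟨x 0⟩
  let _ : TopologicalSpace (FreeGroup X) := ⊥
  have : DiscreteTopology (FreeGroup X) := ⟨rfl⟩
  have := SemidirectProduct.nonarchimedeanGroup hφ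
  have := SemidirectProduct.polishSpace (φ := φ)
  have hG := SemidirectProduct.leftComplete (φ := φ) hN
  let 𝒢' := SemidirectProduct.dgnb (φ := φ) 𝒢
  refine ⟨⟨FreeGroup X ⋊[φ] N, hG.isCLI 𝒢'⟩, hG, 𝒢', SemidirectProduct.bounded_dgnb hφ h, ?_⟩
  intro hb
  obtain ⟨δ, hδ, hδ'⟩ := SemidirectProduct.exists_lt_bounded (fun V hV => by
    obtain ⟨k, hk⟩ := 𝒢.exists_seq_le hV
    refine ⟨FreeGroup.of (x k), fun n hn => hk (hx k n ?_)⟩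
    rw [freeGroupAction_of] at hn
    exact FreeGroup.of_injective hn) hb
  exact h' δ hδ hδ'

/-- The product of countably many copies of groups `K β` of rank `ω * β + 1`, for all `β < α`,
has rank exactly `ω * α`. -/
theorem exists_bounded_mul_omega_and_not_bounded {α : Ordinal.{0}} (hα : α < ω₁)
    (K : Set.Iio α → NonarchCLIPolishGroup.{0}) (hK : ∀ β, LeftComplete (K β).carrier)
    (h : ∀ β, ∃ 𝒢 : DGNB (K β).carrier, 𝒢.Bounded (ω * β.1 + 1) ∧ ¬ 𝒢.Bounded (ω * β.1)) :
    ∃ H : NonarchCLIPolishGroup.{0}, LeftComplete H.carrier ∧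
      ∀ 𝒢 : DGNB H.carrier, 𝒢.Bounded (ω * α) ∧ ∀ δ < ω * α, ¬ 𝒢.Bounded δ := by
  have hcount : Countable α.ToType := by
    rw [← Cardinal.ord_aleph, Cardinal.lt_ord, Cardinal.lt_aleph_one_iff] at hα
    rwa [← Cardinal.mk_le_aleph0_iff, Cardinal.mk_toType]
  -- the second component of the index repeats every factor infinitely often
  let ι := α.ToType × ℕ
  let L : ι → Type := fun i => (K i.1.toOrd).carrier
  have hH : LeftComplete (∀ i, L i) := LeftComplete.pi fun i => hK _
  obtain ⟨𝒢₀⟩ : Nonempty (DGNB (∀ i, L i)) := DGNB.nonempty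
  refine ⟨⟨∀ i, L i, hH.isCLI 𝒢₀⟩, hH, fun 𝒢 => ⟨?_, ?_⟩⟩
  · refine 𝒢.bounded_pi (K := L) fun i 𝒢' => ?_
    obtain ⟨𝒢₁, h₁, -⟩ := h i.1.toOrd
    obtain ⟨c, -, hc⟩ := DGNB.Bounded.exists_nat (k := 1) (by simpa using h₁) 𝒢'
    refine hc.mono ?_
    calc ω * i.1.toOrd.1 + c ≤ ω * i.1.toOrd.1 + ω := by
          gcongr; exact (Ordinal.natCast_lt_omega0 _).le
      _ = ω * Order.succ i.1.toOrd.1 := (Ordinal.mul_succ _ _).symm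
      _ ≤ ω * α := by gcongr; exact Order.succ_le_of_lt i.1.toOrd.2
  · intro δ hδ hb
    have hβ := (Ordinal.lt_mul_iff_div_lt Ordinal.omega0_ne_zero).1 hδ
    obtain ⟨m, hm⟩ := Ordinal.lt_omega0.1 (Ordinal.mod_lt δ Ordinal.omega0_ne_zero)
    rw [← Ordinal.div_add_mod δ ω, hm] at hb
    let b : α.ToType := Ordinal.ToType.mk ⟨δ / ω, hβ⟩
    have hs : (Set.range fun j : ℕ => ((b, j) : ι)).Infinite :=
      Set.infinite_range_of_injective fun j k hjk => (Prod.ext_iff.1 hjk).2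
    obtain ⟨_, ⟨j, rfl⟩, 𝒢', h𝒢'⟩ := DGNB.exists_eval_bounded (K := L) hb hs
    have hbo : (b.toOrd : Set.Iio α) = ⟨δ / ω, hβ⟩ := OrderIso.symm_apply_apply _ _
    obtain ⟨𝒢₁, -, h₁⟩ := h b.toOrd
    refine h₁ ?_
    rw [show δ / ω = b.toOrd.1 from (congrArg Subtype.val hbo).symm] at h𝒢'
    exact h𝒢'.mul_omega 𝒢₁

theorem exists_hierarchy (α : Ordinal.{0}) (hα : α < ω₁) :
    (∃ G : NonarchCLIPolishGroup.{0}, LeftComplete G.carrier ∧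
      ∃ 𝒢 : DGNB G.carrier, 𝒢.Bounded (ω * α + 1) ∧ ¬ 𝒢.Bounded (ω * α)) ∧
    ∃ H : NonarchCLIPolishGroup.{0},
      ∀ 𝒢 : DGNB H.carrier, 𝒢.Bounded (ω * α) ∧ ∀ δ < ω * α, ¬ 𝒢.Bounded δ := by
  induction α using WellFoundedLT.induction with
  | _ α ih =>
  choose K hK h using fun β : Set.Iio α => (ih β.1 β.2 (β.2.trans hα)).1
  obtain ⟨H, hH, hb⟩ := exists_bounded_mul_omega_and_not_bounded hα K hK h
  obtain ⟨𝒢⟩ : Nonempty (DGNB H.carrier) := DGNB.nonempty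
  exact ⟨exists_bounded_add_one_and_not_bounded H.carrier hH 𝒢 (hb 𝒢).1 (hb 𝒢).2, H, hb⟩

theorem mainTheorem7 :
    (∀ α : Ordinal.{0}, α < ω₁ →
      ∃ G H : NonarchCLIPolishGroup.{0},
        G.HasRank α ∧ H.HasRank α ∧
        H.IsAlphaCLI α ∧ G.IsLAlphaCLI α ∧
        ¬ G.IsAlphaCLI α ∧ (∀ 𝒢 : DGNB G.carrier, ω * α < 𝒢.rho)) ∧
    (∀ α β : Ordinal.{0}, β < α → α < ω₁ →
      {G : NonarchCLIPolishGroup.{0} | G.IsAlphaCLI β} ⊂ {G | G.IsLAlphaCLI β} ∧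
      {G : NonarchCLIPolishGroup.{0} | G.IsLAlphaCLI β} ⊂ {G | G.IsAlphaCLI α}) := by
  have main : ∀ α : Ordinal.{0}, α < ω₁ →
      ∃ G H : NonarchCLIPolishGroup.{0},
        G.HasRank α ∧ H.HasRank α ∧
        H.IsAlphaCLI α ∧ G.IsLAlphaCLI α ∧
        ¬ G.IsAlphaCLI α ∧ (∀ 𝒢 : DGNB G.carrier, ω * α < 𝒢.rho) := by
    intro α hα
    obtain ⟨⟨G, -, 𝒢₀, hG, hG'⟩, H, hH⟩ := exists_hierarchy α hα
    have hlt : ∀ 𝒢 : DGNB G.carrier, ω * α < 𝒢.rho := by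
      intro 𝒢
      by_contra! hle
      obtain ⟨c, -, hc⟩ := DGNB.Bounded.exists_nat (k := 1) (by simpa using hG) 𝒢
      exact hG' (((𝒢.bounded_iff _).2 ⟨((𝒢.bounded_iff _).1 hc).1, hle⟩).mul_omega 𝒢₀)
    have hrank : G.HasRank α := fun 𝒢 =>
      Ordinal.div_eq (hlt 𝒢).le (DGNB.rho_lt_of_bounded (𝒢 := 𝒢₀) (k := 1) (by simpa using hG))
    have hrho : ∀ 𝒢 : DGNB H.carrier, 𝒢.rho = ω * α := by
      intro 𝒢
      obtain ⟨hwf, hle⟩ := (𝒢.bounded_iff _).1 (hH 𝒢).1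
      exact hle.antisymm (not_lt.1 fun h => (hH 𝒢).2 _ h ((𝒢.bounded_iff _).2 ⟨hwf, le_rfl⟩))
    refine ⟨G, H, hrank, fun 𝒢 => ?_, fun 𝒢 => (hrho 𝒢).le, fun 𝒢 => (hrank 𝒢).le, ?_, hlt⟩
    · rw [DGNB.rank, hrho, Ordinal.mul_div_cancel _ Ordinal.omega0_ne_zero]
    · exact fun h => (hlt 𝒢₀).not_ge (h 𝒢₀)
  refine ⟨main, fun α β hβα hα => ⟨⟨fun G hG 𝒢 => ?_, fun h => ?_⟩, ⟨fun G hG 𝒢 => ?_, fun h => ?_⟩⟩⟩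
  · exact Ordinal.div_le_of_le_mul (hG 𝒢)
  · obtain ⟨G, -, -, -, -, hL, hG, -⟩ := main β (hβα.trans hα)
    exact hG (h hL)
  · exact ((Ordinal.div_le Ordinal.omega0_ne_zero).1 (hG 𝒢)).le.trans
      (by gcongr; exact Order.succ_le_of_lt hβα)
  · obtain ⟨-, H, -, hrank, hH, -⟩ := main α hα
    obtain ⟨𝒢⟩ : Nonempty (DGNB H.carrier) := DGNB.nonempty
    exact hβα.not_ge ((hrank 𝒢).symm.le.trans (h hH 𝒢))
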